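/- Let $V\subset V'$ be an extension of valuation rings, with fraction fields $K\subset K'$, which is immediate (that is, the inclusion is local and induces equalities of residue fields and of value groups) and algebraic (that is, $K'/K$ is algebraic). Let $\hat V$ be the completion of $V$ for the valuation topology and let $\hat K$ be the fraction field of $\hat V$. Assume that $\operatorname{trdeg}_K\hat K\ge 1$, that the (not necessarily algebraic) field extension $\hat K/K$ is separable, that there exists an immediate extension of valuation rings $V'\subset V_1$ such that $V_1$ is a filtered direct limit of smooth $V$-algebras, and that either $V$ is Henselian or $\dim V=1$. Then $V\subset V'$ is dense: for every $x'\in V'$ and every $\gamma$ in the value group of $V$ there exists $x\in V$ with $\operatorname{val}(x-x')>\gamma$. -/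

import Mathlib

open CategoryTheory

universe u

noncomputable section

/-- The valuation of a valuation ring `V` on its fraction field. It is written multiplicatively
(as always in Mathlib): it takes values in the value group `Kˣ/Vˣ` of `V` with a zero adjoined,
and `val x > γ` in additive notation reads `val x < γ` here. -/
abbrev ringVal (V : Type u) [CommRing V] [IsDomain V] [ValuationRing V] :
    Valuation (FractionRing V) (ValuationRing.ValueGroup V (FractionRing V)) :=
  ValuationRing.valuation V (FractionRing V)

/-- The field extension `K → K'` of fraction fields induced by an inclusion `V ⊂ V'`. -/
def fracMap (V V' : Type u) [CommRing V] [IsDomain V] [CommRing V'] [IsDomain V']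
    [Algebra V V'] [FaithfulSMul V V'] : FractionRing V →+* FractionRing V' :=
  IsFractionRing.map (FaithfulSMul.algebraMap_injective V V')

/-- The map of value groups (with zero) induced by an inclusion `V ⊂ V'`: the class of `x` modulo
units of `V` goes to the class of `x` modulo units of `V'`. -/
def valueGroupMap (V V' : Type u) [CommRing V] [IsDomain V] [CommRing V'] [IsDomain V']
    [Algebra V V'] [FaithfulSMul V V'] :
    ValuationRing.ValueGroup V (FractionRing V) → ValuationRing.ValueGroup V' (FractionRing V') :=
  Quotient.map' (fracMap V V') (by
    rintro _ b ⟨c, rfl⟩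
    refine ⟨Units.map (algebraMap V V').toMonoidHom c, ?_⟩
    simp [fracMap, Units.smul_def, Algebra.smul_def, IsFractionRing.map])

/-- An inclusion `V ⊂ V'` of valuation rings is an immediate extension if it is local and induces
equalities between the residue fields and between the value groups. -/
structure IsImmediateExtension (V V' : Type u) [CommRing V] [IsDomain V] [ValuationRing V]
    [CommRing V'] [IsDomain V'] [ValuationRing V'] [Algebra V V'] [FaithfulSMul V V'] : Prop
    extends IsLocalHom (algebraMap V V') where
  residueField : Function.Bijective (IsLocalRing.ResidueField.map (algebraMap V V'))
  valueGroup : Function.Bijective (valueGroupMap V V')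

/-- An inclusion `V ⊂ V'` of valuation rings is dense if for every `x' ∈ V'` and every `γ` in the
value group of `V` there is `x ∈ V` with `val (x - x') > γ` (additive notation). -/
def IsDenseExtension (V V' : Type u) [CommRing V] [IsDomain V] [ValuationRing V]
    [CommRing V'] [IsDomain V'] [ValuationRing V'] [Algebra V V'] [FaithfulSMul V V'] : Prop :=
  ∀ x' : V', ∀ γ : ValuationRing.ValueGroup V (FractionRing V), γ ≠ 0 →
    ∃ x : V, ringVal V' (algebraMap V' (FractionRing V') (algebraMap V V' x - x')) <
      valueGroupMap V V' γ

/-- `B` is a filtered direct limit (filtered colimit over a small filtered category) of smooth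
`A`-algebras. -/
def IsFilteredLimitOfSmooth (A B : Type u) [CommRing A] [CommRing B] [Algebra A B] : Prop :=
  (MorphismProperty.ind.{u} (RingHom.toMorphismProperty fun f ↦ f.Smooth))
    (CommRingCat.ofHom (algebraMap A B))

/-- The fraction field `K̂` of the completion `V̂` of a valuation ring `V`, realized as the
completion of the fraction field `K` for the topology of the valuation of `V`; inside it `V̂` is the
closure of `V`, that is, the valuation ring of the extended valuation. -/
abbrev CompletionField (V : Type u) [CommRing V] [IsDomain V] [ValuationRing V] : Type u :=
  (ringVal V).Completion

/-- `K̂` as a field extension of `K`, through the canonical embedding of `K` in its completion. -/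
instance CompletionField.algebra (V : Type u) [CommRing V] [IsDomain V] [ValuationRing V] :
    Algebra (FractionRing V) (CompletionField V) :=
  ((UniformSpace.Completion.coeRingHom : WithVal (ringVal V) →+* CompletionField V).comp
    (WithVal.equiv (ringVal V)).symm.toRingHom).toAlgebra

end

/-!
Let `x' ∈ V'` be a root of a nonzero polynomial `f` over `V`. The idea is that `x'` can be specialized
to a root of `f` in a Henselian local ring `R` close to `V`, and that only finitely many positions
are possible for that root.

Smooth algebras over a Henselian local ring have sections through rational points of the special
fibre (`Algebra.Smooth.nonempty_algHom_of_henselianLocalRing`): locally such an algebra is standard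
étale over an affine space. Since `V ⊂ V' ⊂ V₁` are immediate, `V₁` has a point in the residue field
of every local `V`-algebra `R`; as `V₁` is a filtered limit of smooth algebras, every finite system of
polynomial equations over `V` that is solvable in `V₁` is solvable in `R` if `R` is Henselian
(`IsFilteredLimitOfSmooth.exists_aeval_eq_zero`). Equality of the value groups lets one write
`x' - s = d s * (unit)` with `d s ∈ V` for each `s ∈ V`, and these relations for finitely many `s`
can be included in the system. This gives a root `y` of `f` in `R` with `y - s = d s * (unit)` for
all `s` in any prescribed finite set `S ⊂ V`
(`IsFilteredLimitOfSmooth.exists_eval_eq_zero_and_associated`).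

If `V` is Henselian, take `R = V` and for `S` the set of roots of `f` in `V`. Then `y ∈ S`, so
`d y = 0` and `x' = y` lies in `V`.

If `dim V = 1`, take `R = V ⧸ (N)` with `N` nonzero and of large valuation. Its maximal ideal is nil,
so it is Henselian. The elements `y ∈ V` with `N ∣ f(y)` lie in finitely many classes modulo a given
`c ≠ 0` (`Polynomial.exists_finset_dvd_sub_of_dvd_eval`). With `S` a set of representatives,
`c ∣ y - s` for some `s ∈ S`, hence `c ∣ d s`, which says that `s` approximates `x'` up to `c`.
-/

/-! ### Smooth algebras over Henselian local rings -/

open Polynomial in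
/-- Over a Henselian local ring, a point of a standard étale algebra in the residue field lifts. -/
lemma StandardEtalePair.exists_hasMap_of_henselianLocalRing {R : Type*} [CommRing R]
    [HenselianLocalRing R] (P : StandardEtalePair R) {x : IsLocalRing.ResidueField R}
    (hx : P.HasMap x) : ∃ a : R, P.HasMap a := by
  obtain ⟨a, ha, rfl⟩ := (((HenselianLocalRing.TFAE R).out 0 1 :) :
    HenselianLocalRing R ↔ _).mp ‹_› P.f P.monic_f x hx.1 hx.isUnit_derivative_f.ne_zero
  refine ⟨a, by simpa [IsRoot] using ha, ?_⟩
  have h := hx.2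
  rw [← IsLocalRing.ResidueField.algebraMap_eq, aeval_algebraMap_apply] at h
  exact isUnit_of_map_unit (IsLocalRing.residue R) _ h

/-- A smooth algebra over a Henselian local ring which has a rational point over the residue field
has a section. -/
lemma Algebra.Smooth.nonempty_algHom_of_henselianLocalRing {R B : Type*} [CommRing R]
    [HenselianLocalRing R] [CommRing B] [Algebra R B] [Algebra.Smooth R B]
    (φ : B →ₐ[R] IsLocalRing.ResidueField R) : Nonempty (B →ₐ[R] R) := by
  let p : Ideal B := RingHom.ker φ
  have hp : p.IsPrime := RingHom.ker_isPrime φ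
  have : Algebra.IsSmoothAt R p := by
    unfold Algebra.IsSmoothAt
    infer_instance
  obtain ⟨f, hf, n, _, hT, hE⟩ :=
    Algebra.IsSmoothAt.exists_isStandardEtale_mvPolynomial (R := R) (p := p)
  let S := Localization.Away f
  have hfu : IsUnit (φ f) := isUnit_iff_ne_zero.mpr hf
  let φ' : S →ₐ[R] IsLocalRing.ResidueField R :=
    IsLocalization.Away.liftAlgHom (S := S) (x := f) (f := φ) hfu
  obtain ⟨P⟩ := hE.nonempty_standardEtalePresentation
  -- the coordinates of the affine space are lifted arbitrarily
  choose a ha using fun i : Fin n ↦ IsLocalRing.residue_surjective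
    (φ' (algebraMap (MvPolynomial (Fin n) R) S (MvPolynomial.X i)))
  let ev : MvPolynomial (Fin n) R →ₐ[R] R := MvPolynomial.aeval a
  have hev : (φ' : S →+* IsLocalRing.ResidueField R).comp (algebraMap (MvPolynomial (Fin n) R) S) =
      (IsLocalRing.residue R).comp (ev : MvPolynomial (Fin n) R →+* R) := by
    apply MvPolynomial.ringHom_ext
    · intro r
      have : algebraMap (MvPolynomial (Fin n) R) S (MvPolynomial.C r) = algebraMap R S r :=
        (IsScalarTower.algebraMap_apply R (MvPolynomial (Fin n) R) S r).symm
      simp [this, ev]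
    · intro i
      simp [ev, ha]
  have hx : (P.P.map (ev : MvPolynomial (Fin n) R →+* R)).HasMap (φ' P.x) := by
    have key (q : Polynomial (MvPolynomial (Fin n) R)) :
        Polynomial.aeval (φ' P.x) (q.map (ev : MvPolynomial (Fin n) R →+* R)) =
          φ' (Polynomial.aeval P.x q) := by
      rw [Polynomial.aeval_def, Polynomial.eval₂_map, IsLocalRing.ResidueField.algebraMap_eq,
        ← hev, Polynomial.aeval_def]
      exact (Polynomial.hom_eval₂ q _ (φ' : S →+* IsLocalRing.ResidueField R) P.x).symm
    refine ⟨?_, ?_⟩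
    · rw [StandardEtalePair.map_f, key, P.hasMap.1, map_zero]
    · rw [StandardEtalePair.map_g, key]
      exact P.hasMap.2.map φ'
  obtain ⟨b, hb⟩ := StandardEtalePair.exists_hasMap_of_henselianLocalRing _ hx
  let : Algebra (MvPolynomial (Fin n) R) R := (ev : MvPolynomial (Fin n) R →+* R).toAlgebra
  have : IsScalarTower R (MvPolynomial (Fin n) R) R :=
    .of_algebraMap_eq fun r ↦ (ev.commutes r).symm
  have hb' : P.P.HasMap b := by
    simpa [StandardEtalePair.HasMap, Polynomial.aeval_def, Polynomial.eval₂_map,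
      RingHom.algebraMap_toAlgebra] using hb
  let ψ : S →ₐ[MvPolynomial (Fin n) R] R := (P.P.lift b hb').comp P.equivRing.toAlgHom
  exact ⟨(ψ.restrictScalars R).comp (IsScalarTower.toAlgHom R B S)⟩

/-- Base-changed form of `Algebra.Smooth.nonempty_algHom_of_henselianLocalRing`. -/
lemma Algebra.Smooth.nonempty_algHom_of_residueField {A R B : Type*} [CommRing A] [CommRing R]
    [HenselianLocalRing R] [Algebra A R] [CommRing B] [Algebra A B] [Algebra.Smooth A B]
    (φ : B →ₐ[A] IsLocalRing.ResidueField R) : Nonempty (B →ₐ[A] R) := by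
  obtain ⟨ψ⟩ := Algebra.Smooth.nonempty_algHom_of_henselianLocalRing
    (Algebra.TensorProduct.lift (Algebra.ofId R (IsLocalRing.ResidueField R)) φ
      fun _ _ ↦ Commute.all _ _)
  exact ⟨(ψ.restrictScalars A).comp Algebra.TensorProduct.includeRight⟩

/-- A local ring with nil maximal ideal is Henselian, by Newton iteration. -/
lemma HenselianLocalRing.of_forall_isNilpotent {R : Type*} [CommRing R] [IsLocalRing R]
    (h : ∀ x ∈ IsLocalRing.maximalIdeal R, IsNilpotent x) : HenselianLocalRing R where
  is_henselian f _ a₀ h₁ h₂ := by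
    obtain ⟨r, ⟨hr, hr'⟩, -⟩ := Polynomial.existsUnique_nilpotent_sub_and_aeval_eq_zero
      (P := f) (x := a₀) (by simpa using h _ h₁) (by simpa using h₂)
    refine ⟨r, by simpa [Polynomial.IsRoot] using hr', ?_⟩
    rw [← neg_sub, neg_mem_iff]
    obtain ⟨n, hn⟩ := hr
    exact (IsLocalRing.maximalIdeal.isMaximal R).isPrime.mem_of_pow_mem n (hn ▸ zero_mem _)

/-- Solutions of polynomial systems in a filtered direct limit of smooth `A`-algebras with a point
in the residue field of a Henselian local `A`-algebra `R` give solutions in `R`. -/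
lemma IsFilteredLimitOfSmooth.exists_aeval_eq_zero {A C : Type u} [CommRing A] [CommRing C]
    [Algebra A C] (hC : IsFilteredLimitOfSmooth A C) {R : Type*} [CommRing R]
    [HenselianLocalRing R] [Algebra A R] (φ : C →ₐ[A] IsLocalRing.ResidueField R)
    {σ : Type u} [Finite σ] (E : Finset (MvPolynomial σ A)) (z : σ → C)
    (hz : ∀ e ∈ E, MvPolynomial.aeval z e = 0) :
    ∃ w : σ → R, ∀ e ∈ E, MvPolynomial.aeval w e = 0 := by
  obtain ⟨J, _, _, D, t, s, hs, hts⟩ := hC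
  let I : Ideal (MvPolynomial σ A) := Ideal.span E
  let Z := MvPolynomial σ A ⧸ I
  have : Algebra.FinitePresentation A Z := .quotient ⟨E, rfl⟩
  let g : Z →ₐ[A] C := Ideal.Quotient.liftₐ I (MvPolynomial.aeval z) fun e he ↦ by
    have : I ≤ RingHom.ker (MvPolynomial.aeval z : MvPolynomial σ A →ₐ[A] C) :=
      Ideal.span_le.mpr hz
    exact this he
  obtain ⟨j, q, hq, -⟩ := MorphismProperty.exists_hom_of_isFinitelyPresentable hs
    (CommRingCat.isFinitelyPresentable_hom (CommRingCat.ofHom (algebraMap A Z)) (by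
      simpa [RingHom.finitePresentation_algebraMap] using this)) t
    (CommRingCat.ofHom g.toRingHom) (by
      intro j
      rw [(hts j).2]
      ext a
      exact (g.commutes a).symm)
  have hsm : (t.app j).hom.Smooth := (hts j).1
  let B : Type u := D.obj j
  let : Algebra A B := (t.app j).hom.toAlgebra
  have : Algebra.Smooth A B := hsm
  let sj : B →ₐ[A] C :=
    { (s.app j).hom with commutes' := fun a ↦ congr($((hts j).2).hom a) }
  obtain ⟨ψ⟩ := Algebra.Smooth.nonempty_algHom_of_residueField (φ.comp sj)
  let qj : Z →ₐ[A] B := { q.hom with commutes' := fun a ↦ congr(($hq).hom a) }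
  refine ⟨fun i ↦ ψ (qj (Ideal.Quotient.mkₐ A I (MvPolynomial.X i))), fun e he ↦ ?_⟩
  have : MvPolynomial.aeval (fun i ↦ ψ (qj (Ideal.Quotient.mkₐ A I (MvPolynomial.X i)))) =
      (ψ.comp qj).comp (Ideal.Quotient.mkₐ A I) := by
    ext i
    rw [MvPolynomial.aeval_X]
    rfl
  rw [this]
  have he' : Ideal.Quotient.mkₐ A I e = 0 :=
    Ideal.Quotient.eq_zero_iff_mem.mpr (Ideal.subset_span he : e ∈ I)
  rw [AlgHom.comp_apply, he', map_zero]

/-! ### Approximate roots -/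

open Polynomial in
/-- The approximate roots of a polynomial of degree `n` and leading coefficient `l` over a valuation
ring lie in finitely many residue classes modulo `c`; a precision `l * π * c ^ n` with `π` not a unit
suffices. -/
lemma Polynomial.exists_finset_dvd_sub_of_dvd_eval {V : Type*} [CommRing V] [IsDomain V]
    [ValuationRing V] {c π l : V} (hc : c ≠ 0) (hπ : ¬ IsUnit π) (hl : l ≠ 0) (n : ℕ) :
    ∀ f : V[X], f.natDegree = n → f.leadingCoeff = l →
      ∃ S : Finset V, ∀ y, l * π * c ^ n ∣ f.eval y → ∃ s ∈ S, c ∣ y - s := by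
  classical
  induction n with
  | zero =>
    intro f hf hfl
    refine ⟨∅, fun y hy ↦ (hπ ?_).elim⟩
    rw [Polynomial.eq_C_of_natDegree_eq_zero hf, Polynomial.eval_C] at hy
    rw [Polynomial.leadingCoeff, hf] at hfl
    rw [hfl, pow_zero, mul_one] at hy
    exact isUnit_of_dvd_one ((mul_dvd_mul_iff_left hl).mp (by simpa using hy))
  | succ n ih =>
    intro f hf hfl
    -- divide `f - f(y₀)` by `X - y₀` for one approximate root `y₀`: the quotient has the same leading
    -- coefficient, and all approximate roots of `f` away from `y₀` are approximate roots of it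
    by_cases h : ∃ y₀, l * π * c ^ (n + 1) ∣ f.eval y₀
    swap
    · exact ⟨∅, fun y hy ↦ (h ⟨y, hy⟩).elim⟩
    obtain ⟨y₀, hy₀⟩ := h
    have hroot : (f - C (f.eval y₀)).IsRoot y₀ := by simp
    obtain ⟨g, hg⟩ := Polynomial.dvd_iff_isRoot.mpr hroot
    have hdeg : (f - C (f.eval y₀)).natDegree = n + 1 := by rw [natDegree_sub_C, hf]
    have hg0 : g ≠ 0 := by
      rintro rfl
      simp [hg] at hdeg
    have hgn : g.natDegree = n := by
      rw [hg, natDegree_mul (X_sub_C_ne_zero _) hg0, natDegree_X_sub_C] at hdeg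
      omega
    have hgl : g.leadingCoeff = l := by
      have h1 : (f - C (f.eval y₀)).leadingCoeff = l := by
        rw [leadingCoeff_sub_of_degree_lt, hfl]
        refine degree_C_le.trans_lt (natDegree_pos_iff_degree_pos.mp (by omega))
      rwa [hg, leadingCoeff_mul, leadingCoeff_X_sub_C, one_mul] at h1
    obtain ⟨S, hS⟩ := ih g hgn hgl
    refine ⟨insert y₀ S, fun y hy ↦ ?_⟩
    obtain ⟨e, he | he⟩ := ValuationRing.cond c (y - y₀)
    · exact ⟨y₀, Finset.mem_insert_self _ _, e, he.symm⟩
    have hfg : f.eval y - f.eval y₀ = (y - y₀) * g.eval y := by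
      simpa using congr(eval y $hg)
    have hd : l * π * c ^ (n + 1) ∣ (y - y₀) * g.eval y := hfg ▸ dvd_sub hy hy₀
    have hd' : c * (l * π * c ^ n) ∣ c * g.eval y := by
      obtain ⟨k, hk⟩ := hd
      exact ⟨e * k, by linear_combination e * hk - g.eval y * he⟩
    obtain ⟨s, hs, hys⟩ := hS y ((mul_dvd_mul_iff_left hc).mp hd')
    exact ⟨s, Finset.mem_insert_of_mem hs, hys⟩

/-! ### Immediate extensions and density -/

/-- In an immediate extension `V ⊂ V'`, every element of `V'` is an element of `V` up to a unit. -/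
lemma IsImmediateExtension.exists_associated {V V' : Type u} [CommRing V] [IsDomain V]
    [ValuationRing V] [CommRing V'] [IsDomain V'] [ValuationRing V'] [Algebra V V']
    [FaithfulSMul V V'] (h : IsImmediateExtension V V') (z : V') :
    ∃ d : V, Associated (algebraMap V V' d) z := by
  obtain ⟨q, hq⟩ := h.valueGroup.surjective (Quotient.mk'' (algebraMap V' (FractionRing V') z))
  obtain ⟨k, rfl⟩ := Quotient.mk''_surjective q
  obtain ⟨c, hc⟩ := Quotient.exact' hq
  replace hc : algebraMap V' (FractionRing V') (c * z) = fracMap V V' k := by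
    simpa [Units.smul_def, Algebra.smul_def] using hc
  have hmap (v : V) : fracMap V V' (algebraMap V (FractionRing V) v) =
      algebraMap V' (FractionRing V') (algebraMap V V' v) := by
    simp [fracMap, IsFractionRing.map]
  have hinj := IsFractionRing.injective V' (FractionRing V')
  obtain ⟨d, rfl⟩ | ⟨d, hd⟩ := ValuationRing.isInteger_or_isInteger V k
  · rw [hmap] at hc
    refine ⟨d, Associated.symm ⟨c, ?_⟩⟩
    rw [mul_comm, hinj hc]
  · by_cases hk : k = 0
    · rw [hk, map_zero, map_eq_zero_iff _ hinj, Units.mul_right_eq_zero] at hc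
      exact ⟨0, by simp [hc]⟩
    -- an element of negative value cannot occur, so here `z` is a unit
    · have h1 : c * z * algebraMap V V' d = 1 := by
        apply hinj
        rw [map_mul, hc, ← hmap, hd, ← map_mul, mul_inv_cancel₀ hk, map_one, map_one]
      refine ⟨1, ?_⟩
      rw [map_one]
      exact (associated_one_iff_isUnit.mpr (.of_mul_eq_one (c * algebraMap V V' d)
        (by linear_combination h1))).symm

/-- If `V ⊂ V' ⊂ V₁` are immediate, all three rings have the same residue field, so that `V₁` has a
point over `V` in the residue field of any local `V`-algebra `R`. -/
lemma IsImmediateExtension.nonempty_algHom_residueField {V V' V₁ R : Type u} [CommRing V]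
    [IsDomain V] [ValuationRing V] [CommRing V'] [IsDomain V'] [ValuationRing V'] [Algebra V V']
    [FaithfulSMul V V'] [CommRing V₁] [IsDomain V₁] [ValuationRing V₁] [Algebra V' V₁]
    [FaithfulSMul V' V₁] [Algebra V V₁] [IsScalarTower V V' V₁]
    (h : IsImmediateExtension V V') (h₁ : IsImmediateExtension V' V₁) [CommRing R] [IsLocalRing R]
    [Algebra V R] [IsLocalHom (algebraMap V R)] :
    Nonempty (V₁ →ₐ[V] IsLocalRing.ResidueField R) := by
  have := h.toIsLocalHom
  have := h₁.toIsLocalHom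
  let e := RingEquiv.ofBijective _ h.residueField
  let e₁ := RingEquiv.ofBijective _ h₁.residueField
  let g : V₁ →+* IsLocalRing.ResidueField R := (IsLocalRing.ResidueField.map (algebraMap V R)).comp
    (e.symm.toRingHom.comp (e₁.symm.toRingHom.comp (IsLocalRing.residue V₁)))
  refine ⟨⟨g, fun v ↦ ?_⟩⟩
  have h1 : e₁.symm (IsLocalRing.residue V₁ (algebraMap V V₁ v)) =
      IsLocalRing.residue V' (algebraMap V V' v) := by
    rw [RingEquiv.symm_apply_eq, IsScalarTower.algebraMap_apply V V' V₁]
    rfl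
  have h2 : e.symm (IsLocalRing.residue V' (algebraMap V V' v)) = IsLocalRing.residue V v := by
    rw [RingEquiv.symm_apply_eq]
    rfl
  change IsLocalRing.ResidueField.map (algebraMap V R)
    (e.symm (e₁.symm (IsLocalRing.residue V₁ (algebraMap V V₁ v)))) = _
  rw [h1, h2]
  rfl

/-- A root `z` of `f` in a filtered direct limit of smooth `A`-algebras specializes to a root `y` in
a Henselian local ring `R`, and `y` can be chosen to lie at the same distances as `z` from finitely
many given points of `A`. -/
lemma IsFilteredLimitOfSmooth.exists_eval_eq_zero_and_associated {A C : Type u} [CommRing A]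
    [CommRing C] [Algebra A C] (hC : IsFilteredLimitOfSmooth A C) {R : Type*} [CommRing R]
    [HenselianLocalRing R] [Algebra A R] (φ : C →ₐ[A] IsLocalRing.ResidueField R)
    {f : Polynomial A} {z : C} (hf : Polynomial.aeval z f = 0) (S : Finset A) (d : A → A)
    (hd : ∀ s ∈ S, Associated (algebraMap A C (d s)) (z - algebraMap A C s)) :
    ∃ y : R, Polynomial.aeval y f = 0 ∧
      ∀ s ∈ S, Associated (algebraMap A R (d s)) (y - algebraMap A R s) := by
  classical
  choose! u hu using hd
  -- the unknowns: the root `Y`, and for each `s` a unit `U s` with its inverse `W s`; the equations: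
  -- `f Y = 0`, `d s * U s = Y - s`, `U s * W s = 1`
  let Y : MvPolynomial (Option (S ⊕ S)) A := MvPolynomial.X none
  let U (s : S) : MvPolynomial (Option (S ⊕ S)) A := MvPolynomial.X (some (Sum.inl s))
  let W (s : S) : MvPolynomial (Option (S ⊕ S)) A := MvPolynomial.X (some (Sum.inr s))
  let E : Finset (MvPolynomial (Option (S ⊕ S)) A) := {Polynomial.aeval Y f} ∪
    (Finset.univ.image fun s : S ↦ MvPolynomial.C (d s) * U s - (Y - MvPolynomial.C s.1)) ∪
    (Finset.univ.image fun s : S ↦ U s * W s - 1)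
  obtain ⟨w, hw⟩ := hC.exists_aeval_eq_zero φ E (fun o ↦ o.elim z
      (Sum.elim (fun s ↦ (u s : C)) (fun s ↦ ((u s)⁻¹ : Cˣ)))) (by
    simp only [E, Finset.mem_union, Finset.mem_singleton, Finset.mem_image, Finset.mem_univ,
      true_and]
    rintro _ ((rfl | ⟨s, rfl⟩) | ⟨s, rfl⟩)
    · rw [← Polynomial.aeval_algHom_apply]
      simpa [Y] using hf
    · simp [Y, U, hu s.1 s.2]
    · simp [U, W])
  simp only [E, Finset.mem_union, Finset.mem_singleton, Finset.mem_image, Finset.mem_univ,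
      true_and] at hw
  refine ⟨w none, ?_, fun s hs ↦ ?_⟩
  · have := hw _ (.inl (.inl rfl))
    rw [← Polynomial.aeval_algHom_apply] at this
    simpa [Y] using this
  · have h1 := hw _ (.inl (.inr ⟨⟨s, hs⟩, rfl⟩))
    have h2 := hw _ (.inr ⟨⟨s, hs⟩, rfl⟩)
    simp only [Y, U, W, map_sub, map_mul, MvPolynomial.aeval_C, MvPolynomial.aeval_X, map_one,
      sub_eq_zero] at h1 h2
    exact ⟨.mkOfMulEqOne _ _ h2, h1⟩

/-- In dimension one the maximal ideal is the radical of every nonzero proper principal ideal, so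
the quotients by these ideals have nil maximal ideals. -/
lemma HenselianLocalRing.quotient_span_singleton_of_ringKrullDim_eq_one {V : Type*} [CommRing V]
    [IsDomain V] [IsLocalRing V] (hV : ringKrullDim V = 1) {N : V} (hN : N ≠ 0)
    (hN' : ¬ IsUnit N) : HenselianLocalRing (V ⧸ Ideal.span {N}) := by
  have : Nontrivial (V ⧸ Ideal.span {N}) :=
    Ideal.Quotient.nontrivial_iff.mpr (by simpa [Ideal.span_singleton_eq_top] using hN')
  have hloc : IsLocalRing (V ⧸ Ideal.span {N}) :=
    .of_surjective' (Ideal.Quotient.mk _) Ideal.Quotient.mk_surjective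
  refine .of_forall_isNilpotent fun x hx ↦ ?_
  obtain ⟨v, rfl⟩ := Ideal.Quotient.mk_surjective x
  have hv : v ∈ IsLocalRing.maximalIdeal V := fun h ↦ hx (h.map (Ideal.Quotient.mk _))
  obtain ⟨n, hn⟩ := (ringKrullDim_eq_one_iff_of_isLocalRing_isDomain.mp hV).2 N hN hv
  exact ⟨n, by rw [← map_pow]; exact Ideal.Quotient.eq_zero_iff_mem.mpr hn⟩

/-- A fraction `a / b` has at least the multiplicative value of its numerator. -/
lemma exists_ringVal_le_valueGroupMap {V V' : Type u} [CommRing V] [IsDomain V] [ValuationRing V]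
    [CommRing V'] [IsDomain V'] [ValuationRing V'] [Algebra V V'] [FaithfulSMul V V']
    {γ : ValuationRing.ValueGroup V (FractionRing V)} (hγ : γ ≠ 0) :
    ∃ a : V, a ≠ 0 ∧
      ringVal V' (algebraMap V' (FractionRing V') (algebraMap V V' a)) ≤ valueGroupMap V V' γ := by
  obtain ⟨k, rfl⟩ := Quotient.mk''_surjective γ
  obtain ⟨a, b, hb, rfl⟩ := IsFractionRing.div_surjective V k
  refine ⟨a, ?_, algebraMap V V' b, ?_⟩
  · rintro rfl
    refine hγ ?_
    simp
    rfl
  · have hb' : algebraMap V' (FractionRing V') (algebraMap V V' b) ≠ 0 := by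
      have := nonZeroDivisors.ne_zero hb
      simpa using this
    simp [fracMap, IsFractionRing.map, Algebra.smul_def]
    field_simp

theorem theorem3 (V V' : Type u)
    [CommRing V] [IsDomain V] [ValuationRing V]
    [CommRing V'] [IsDomain V'] [ValuationRing V']
    [Algebra V V'] [FaithfulSMul V V']
    (himm : IsImmediateExtension V V')
    (halg : Algebra.IsAlgebraic V V')
    (htrdeg : 1 ≤ Algebra.trdeg (FractionRing V) (CompletionField V))
    (hsep : Algebra.IsGeometricallyReduced (FractionRing V) (CompletionField V))
    (hsmooth : ∃ (V₁ : Type u) (_ : CommRing V₁) (_ : IsDomain V₁) (_ : ValuationRing V₁)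
      (_ : Algebra V' V₁) (_ : FaithfulSMul V' V₁) (_ : Algebra V V₁) (_ : IsScalarTower V V' V₁),
      IsImmediateExtension V' V₁ ∧ IsFilteredLimitOfSmooth V V₁)
    (hV : HenselianLocalRing V ∨ ringKrullDim V = 1) :
    IsDenseExtension V V' := by
  classical
  obtain ⟨V₁, _, _, _, _, _, _, _, himm₁, hsm⟩ := hsmooth
  intro x' γ hγ
  obtain ⟨f, hf0, hf⟩ := halg.isAlgebraic x'
  obtain ⟨a, ha0, ha⟩ := exists_ringVal_le_valueGroupMap (V' := V') hγ
  have hf₁ : Polynomial.aeval (algebraMap V' V₁ x') f = 0 := by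
    rw [Polynomial.aeval_algebraMap_apply, hf, map_zero]
  choose d hd using fun s : V ↦ himm.exists_associated (x' - algebraMap V V' s)
  have hd₁ (s : V) : Associated (algebraMap V V₁ (d s))
      (algebraMap V' V₁ x' - algebraMap V V₁ s) := by
    simpa [IsScalarTower.algebraMap_apply V V' V₁] using (hd s).map (algebraMap V' V₁)
  -- the nonunit `π` makes the inequality strict
  suffices ∃ s : V, d s = 0 ∨ ∃ π : V, ¬ IsUnit π ∧ a * π ∣ d s by
    obtain ⟨s, hs⟩ := this
    refine ⟨s, lt_of_lt_of_le (lt_of_not_ge ?_) ha⟩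
    rintro ⟨e, he⟩
    obtain ⟨u, hu⟩ := hd s
    replace he : e * (algebraMap V V' s - x') = algebraMap V V' a :=
      IsFractionRing.injective V' (FractionRing V') (by simpa [Algebra.smul_def] using he)
    have hea : algebraMap V V' a = algebraMap V V' (d s) * (-(e * u)) := by
      linear_combination -he + e * hu
    have ha0' : algebraMap V V' a ≠ 0 := by simpa using ha0
    obtain hs | ⟨π, hπ, t, ht⟩ := hs
    · exact ha0' (by rw [hea, hs, map_zero, zero_mul])
    · have := himm.toIsLocalHom
      refine hπ (isUnit_of_map_unit (algebraMap V V') π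
        (.of_mul_eq_one (algebraMap V V' t * (-(e * u))) (mul_left_cancel₀ ha0' ?_)))
      rw [ht, map_mul, map_mul] at hea
      linear_combination -hea
  obtain hV | hV := hV
  · -- the root of `f` in `V` to which `x'` specializes is at distance `0` from itself, hence so is
    -- `x'`
    obtain ⟨φ⟩ := himm.nonempty_algHom_residueField himm₁ (R := V)
    obtain ⟨y, hy, hyS⟩ := hsm.exists_eval_eq_zero_and_associated φ hf₁ f.roots.toFinset d
      fun s _ ↦ hd₁ s
    refine ⟨y, .inl ?_⟩
    have hy' : y ∈ f.roots.toFinset := by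
      simpa [hf0] using hy
    simpa using hyS y hy'
  · obtain ⟨hfield, -⟩ := ringKrullDim_eq_one_iff_of_isLocalRing_isDomain.mp hV
    obtain ⟨π, hπ0, hπ⟩ := Ring.exists_not_isUnit_of_not_isField hfield
    have hc0 : a * π ≠ 0 := mul_ne_zero ha0 hπ0
    have hl : f.leadingCoeff ≠ 0 := Polynomial.leadingCoeff_ne_zero.mpr hf0
    obtain ⟨S, hS⟩ := Polynomial.exists_finset_dvd_sub_of_dvd_eval hc0 hπ hl f.natDegree f rfl rfl
    -- the last factor of `N` ensures that divisibility by `a * π` can be tested modulo `N`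
    let N := (f.leadingCoeff * π * (a * π) ^ f.natDegree) * (a * π)
    have hN0 : N ≠ 0 := mul_ne_zero (mul_ne_zero (mul_ne_zero hl hπ0) (pow_ne_zero _ hc0)) hc0
    have hπN : π ∣ N := ⟨f.leadingCoeff * π * (a * π) ^ f.natDegree * a, by ring⟩
    have hN : ¬ IsUnit N := fun h ↦ hπ (isUnit_of_dvd_unit hπN h)
    let R := V ⧸ Ideal.span {N}
    have : HenselianLocalRing R :=
      .quotient_span_singleton_of_ringKrullDim_eq_one hV hN0 hN
    have hlocal : IsLocalHom (algebraMap V R) :=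
      .of_surjective _ Ideal.Quotient.mk_surjective
    obtain ⟨φ⟩ := himm.nonempty_algHom_residueField himm₁ (R := R)
    obtain ⟨y, hy, hyS⟩ := hsm.exists_eval_eq_zero_and_associated φ hf₁ S d fun s _ ↦ hd₁ s
    obtain ⟨y, rfl⟩ := Ideal.Quotient.mk_surjective y
    have hNy : N ∣ f.eval y := by
      rw [← Ideal.mem_span_singleton, ← Ideal.Quotient.eq_zero_iff_mem, ← hy]
      exact (Polynomial.aeval_algebraMap_apply_eq_algebraMap_eval y f).symm
    obtain ⟨s, hs, hys⟩ := hS y ((Dvd.intro _ rfl).trans hNy)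
    refine ⟨s, .inr ⟨π, hπ, ?_⟩⟩
    obtain ⟨u, hu⟩ := (hyS s hs).symm
    obtain ⟨w, hw⟩ := Ideal.Quotient.mk_surjective (u : R)
    have hNd : N ∣ (y - s) * w - d s := by
      rw [← Ideal.mem_span_singleton, ← Ideal.Quotient.eq_zero_iff_mem, map_sub, map_mul, hw,
        sub_eq_zero]
      exact hu
    have h2 : a * π ∣ (y - s) * w - d s := (Dvd.intro_left _ rfl).trans hNd
    exact (dvd_sub_right (hys.mul_right w)).mp h2
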